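/- **Proposition (rates of convergence in the noisy case).** Let $d\ge 1$, let $|\cdot|$ be a norm on $\mathbb R^d$, let $v_d$ be the Lebesgue volume of its unit ball, and let $B(x,r)$ be its closed balls. Let $\mathbf\Theta$ be a measurable space, let $f:\mathbb R^d\times\mathbf\Theta\to\mathbb R^e$ and $\phi:\mathbb R^e\to\mathbb R$ be measurable, and let $\mu_X,\mu_{X'}$ be probability measures on $\mathbb R^d$ and $\mu_\Theta$ one on $\mathbf\Theta$. Put $\mathrm{QI}=\mathbb E[\phi(f(X,\Theta))]$, where $X\sim\mu_X$ and $\Theta\sim\mu_\Theta$ are independent, and $\psi(x)=\mathbb E[\phi(f(x,\Theta))]$. Let $(X_i)_{i\ge1}$ be i.i.d. with law $\mu_X$ and, independently of them, let $(X'_j,\Theta_j)_{j\ge1}$ be i.i.d. with law $\mu_{X'}\otimes\mu_\Theta$; put $Y'_j=f(X'_j,\Theta_j)$. For $1\le k\le m$ and $n\ge1$ let $$\widehat{\mathrm{QI}}{}^{(k)}_{m,n}=\frac1n\sum_{i=1}^n\frac1k\sum_{l=1}^k\phi\big(Y'_{j_i^{(l)}}\big),$$ where $j_i^{(1)},\dots,j_i^{(m)}$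 is the permutation of $1,\dots,m$ that orders $X'_1,\dots,X'_m$ by increasing distance $|X_i-X'_j|$, ties being broken in favour of the lowest index $j$. Assume that: 1. $\phi$ is bounded and $\psi$ is globally Lipschitz continuous; 2. $\mathbb E[\min_{1\le j\le m_0}|X'_j|]<\infty$ for some integer $m_0\ge1$, and $\mathbb E[|X|^2]<\infty$; 3. there is an open set $U\supset\mathrm{supp}(\mu_X)$ such that $\mu_{X'}(\cdot\cap U)$ has a density $p_{X'}$ with respect to the Lebesgue measure, $p_{X'}$ is continuous and positive on $U$, and for some $\kappa\in(0,1]$ and $r_\kappa>0$ one has $\mu_{X'}(B(x,r))\ge\kappa\,p_{X'}(x)\,v_d\,r^d$ for all $x\in U$ and $r\in[0,r_\kappa]$; 4. $\mathbb E\big[(1+|X|^2)/p_{X'}(X)^{2/d}\big]<\infty$. Let $\tau_{1,d}:\mathbb N\to[0,\infty)$ be such that $\mathbb E\big[W_1\big(\mu_X,\tfrac1n\sum_{i=1}^n\delta_{X_i}\big)\big]=O(\tau_{1,d}(n))$ as $n\to\infty$, where $W_1$ is the Wasserstein distance of order $1$ for $|\cdot|$, and let $(k_m)_{m\ge1}$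 be a nondecreasing sequence of positive integers such that $k_m\sim m^{2/(d+2)}$ as $m\to\infty$. Then $$\mathbb E\Big[\big|\mathrm{QI}-\widehat{\mathrm{QI}}{}^{(k_m)}_{m,n}\big|^2\Big]^{1/2}=O\Big(\frac1{\sqrt n}+\tau_{1,d}(n)\Big)+O\Big(\frac1{m^{1/(d+2)}}\Big),$$ that is, there is a constant $C$ such that for all $n\ge1$ and all $m\ge1$ with $k_m\le m$ the left-hand side is finite and at most $C\,(n^{-1/2}+\tau_{1,d}(n))+C\,m^{-1/(d+2)}$. -/

import Mathlib

open MeasureTheory ProbabilityTheory Filter Asymptotics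
open scoped ENNReal NNReal

noncomputable section

/-- The Wasserstein distance of order `q`, with values in `[0, ∞]`: the `q`-th root of the infimum
of the transport cost over all couplings of `μ` and `ν`. -/
def wassersteinDist {E : Type*} [NormedAddCommGroup E] [MeasurableSpace E]
    (q : ℝ) (μ ν : Measure E) : ℝ≥0∞ :=
  (⨅ (γ : Measure (E × E)) (_ : γ.map Prod.fst = μ ∧ γ.map Prod.snd = ν),
    ∫⁻ z, ‖z.1 - z.2‖ₑ ^ q ∂γ) ^ (1 / q)

/-- The empirical measure `(1/n) ∑ δ_{x_i}`. -/
def empiricalMeasure {E : Type*} [MeasurableSpace E] {n : ℕ} (x : Fin n → E) : Measure E :=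
  (n : ℝ≥0∞)⁻¹ • ∑ i, Measure.dirac (x i)

/-- The ordering of the training points by distance to `x`: the index `neighborIndex x' x l` is that
of the `(l+1)`-th nearest neighbour of `x` among `x'`. `Tuple.sort` is the stable sort, so that ties
are broken in favour of the lowest index, and the result is a permutation of the indices. -/
def neighborIndex {E : Type*} [NormedAddCommGroup E] {m : ℕ} (x' : Fin m → E) (x : E) :
    Equiv.Perm (Fin m) :=
  Tuple.sort (fun j => ‖x - x' j‖)

/-- The `k`-nearest-neighbour estimator at `x` of the regression function, from the training sample
`(x'_j, y'_j)`: the mean of `φ (y'_j)` over the `k` nearest neighbours of `x` (meant for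
`1 ≤ k ≤ m`). -/
def knnRegression {E F : Type*} [NormedAddCommGroup E] (φ : F → ℝ) (k : ℕ) {m : ℕ}
    (x' : Fin m → E) (y' : Fin m → F) (x : E) : ℝ :=
  (1 / (k : ℝ)) * ∑ l ∈ Finset.univ.filter (fun l : Fin m => (l : ℕ) < k), φ (y' (neighborIndex x' x l))

/-- The estimator of the quantity of interest: the mean of the `k`-nearest-neighbour estimator over
the evaluation sample `x`. -/
def estimatedQI {E F : Type*} [NormedAddCommGroup E] (φ : F → ℝ) (k : ℕ) {m n : ℕ}
    (x' : Fin m → E) (y' : Fin m → F) (x : Fin n → E) : ℝ :=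
  (1 / (n : ℝ)) * ∑ i, knnRegression φ k x' y' (x i)

/-- The quantity of interest `E[φ(Y)]`, where `Y = f (X, Θ)` with `X ∼ μX` and `Θ ∼ μΘ`
independent. -/
def quantityOfInterest {E T F : Type*} [MeasurableSpace E] [MeasurableSpace T] [MeasurableSpace F]
    (μX : Measure E) (μΘ : Measure T) (f : E × T → F) (φ : F → ℝ) : ℝ :=
  ∫ y, φ y ∂((μX.prod μΘ).map f)

/-- The sampling model of regression under covariate shift: an i.i.d. evaluation sample
`X i ∼ μX`; i.i.d. pairs `(X' j, Θ j)` where `X' j ∼ μX'` and `Θ j ∼ μΘ` are independent; the two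
samples are independent of each other. -/
structure IsCovariateShiftSample {Ω E T : Type*} [MeasurableSpace Ω] [MeasurableSpace E]
    [MeasurableSpace T] (P : Measure Ω) (μX μX' : Measure E) (μΘ : Measure T)
    (X X' : ℕ → Ω → E) (Θ : ℕ → Ω → T) : Prop where
  measurable_X : ∀ i, Measurable (X i)
  measurable_X' : ∀ j, Measurable (X' j)
  measurable_Θ : ∀ j, Measurable (Θ j)
  law_X : ∀ i, P.map (X i) = μX
  law_X' : ∀ j, P.map (X' j) = μX'
  law_Θ : ∀ j, P.map (Θ j) = μΘ
  indep_X : iIndepFun X P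
  indep_pairs : iIndepFun (fun j ω => (X' j ω, Θ j ω)) P
  indep_X'_Θ : ∀ j, IndepFun (X' j) (Θ j) P
  indep_samples : IndepFun (fun ω i => X i ω) (fun ω j => (X' j ω, Θ j ω)) P

/-- The strong support condition, with open set `U` and density `p`, relative to the Lebesgue
measure `lam` on the `d`-dimensional space `E`; `lam.real (Metric.closedBall 0 1)` is the volume
`v_d` of the unit ball. -/
structure StrongSupportCondition {E : Type*} [NormedAddCommGroup E] [MeasurableSpace E]
    (d : ℕ) (lam μX μX' : Measure E) (U : Set E) (p : E → ℝ) : Prop where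
  isOpen : IsOpen U
  support_subset : μX.support ⊆ U
  density : μX'.restrict U = (lam.restrict U).withDensity (fun x => ENNReal.ofReal (p x))
  continuousOn : ContinuousOn p U
  pos : ∀ x ∈ U, 0 < p x
  minimal_mass : ∃ κ : ℝ, 0 < κ ∧ κ ≤ 1 ∧ ∃ rκ : ℝ, 0 < rκ ∧ ∀ x ∈ U, ∀ r : ℝ, 0 ≤ r → r ≤ rκ →
    ENNReal.ofReal (κ * p x * lam.real (Metric.closedBall 0 1) * r ^ d)
      ≤ μX' (Metric.closedBall x r)

end

/-! Let `ψ` be the regression function. The error splits into the Monte Carlo error of `ψ` over the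
evaluation sample and the mean over that sample of the regression error. The first has mean square
at most `B ^ 2 / n`, because `ψ` is bounded and the `X i` are i.i.d.; this already lies within the
allowed `n ^ (-1/2) + τ n`. By Cauchy–Schwarz, and because each `X i` is independent of the training
data, the second reduces to the error at one point `x`, integrated against `μX`.

At fixed covariates the pointwise error is a variance of at most `B ^ 2 / k` plus a squared bias. A
bounded Lipschitz `ψ` has bias controlled by the distances to the neighbours, truncated at the
radius up to which ball masses are bounded below. The `k` nearest neighbours are jointly no farther
than the nearest points of `k` disjoint blocks of size `M = m / k`
(`sum_neighborIndex_le_sum_blocks`). The nearest point of a block is beyond `t` with probability at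
most `exp (-M q t ^ d)`, where `q` is proportional to `p x`, so its truncated second moment is of
order `(M q) ^ (-2/d)` (`lintegral_sq_min_nearest_le`).

The moment condition makes `p ^ (-2/d)` integrable. The choice `k ∼ m ^ (2/(d+2))` balances `1 / k`
against `(k / m) ^ (2/d)`, both then of order `m ^ (-2/(d+2))`. -/

/-! ### Sums of smallest values, and measurability of sorting -/

/-- Among all sums of `k` values of a monotone sequence at distinct places, the sum of the first
`k` values is the smallest. -/
lemma sum_castLE_le_sum_of_injective {m k : ℕ} (hkm : k ≤ m) {h : Fin m → ℝ} (hh : Monotone h)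
    {c : Fin k → Fin m} (hc : Function.Injective c) :
    ∑ l : Fin k, h (Fin.castLE hkm l) ≤ ∑ b, h (c b) := by
  classical
  have hcard : (Finset.univ.map ⟨c, hc⟩).card = k := by simp
  set s := (Finset.univ.map ⟨c, hc⟩).orderEmbOfFin hcard with hs
  have h1 : ∑ b, h (c b) = ∑ i, h (s i) := by
    have : ∑ t ∈ Finset.univ.map ⟨c, hc⟩, h t = ∑ i, h (s i) := by
      rw [← Finset.map_orderEmbOfFin_univ _ hcard, Finset.sum_map]
      rfl
    rw [← this, Finset.sum_map]
    rfl
  -- In a strictly increasing enumeration of naturals the entry at place `i` is at least `i`.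
  have h2 : ∀ (i : ℕ) (hi : i < k), i ≤ (s ⟨i, hi⟩ : ℕ) := by
    intro i
    induction i with
    | zero => intro _; exact Nat.zero_le _
    | succ i ih =>
      intro hi
      have h3 : s ⟨i, by omega⟩ < s ⟨i + 1, hi⟩ := s.strictMono (by simp [Fin.lt_def])
      have h4 := ih (by omega)
      rw [Fin.lt_def] at h3
      omega
  rw [h1]
  exact Finset.sum_le_sum fun i _ => hh (h2 i i.2)

lemma sum_filter_val_lt {m k : ℕ} (hkm : k ≤ m) (h : Fin m → ℝ) :
    ∑ l ∈ Finset.univ.filter (fun l : Fin m => (l : ℕ) < k), h l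
      = ∑ l : Fin k, h (Fin.castLE hkm l) := by
  symm
  refine Finset.sum_bij (fun l _ => Fin.castLE hkm l) (fun l _ => by simp) ?_ ?_ (fun _ _ => rfl)
  · intro a _ b _ hab
    simpa using hab
  · intro b hb
    simp only [Finset.mem_filter, Finset.mem_univ, true_and] at hb
    exact ⟨⟨b, hb⟩, Finset.mem_univ _, rfl⟩

/-- A stable sort is characterised by finitely many comparisons: weak monotonicity, and index order
wherever values tie. -/
lemma measurableSet_sort_eq {α : Type*} [MeasurableSpace α] {m : ℕ} {g : Fin m → α → ℝ}
    (hg : ∀ j, Measurable (g j)) (σ : Equiv.Perm (Fin m)) :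
    MeasurableSet {a | Tuple.sort (fun j => g j a) = σ} := by
  have h : {a | Tuple.sort (fun j => g j a) = σ}
      = (⋂ i, ⋂ j, ⋂ (_ : i ≤ j), {a | g (σ i) a ≤ g (σ j) a}) ∩
        ⋂ i, ⋂ j, ⋂ (_ : i < j), {a | g (σ i) a = g (σ j) a → σ i < σ j} := by
    ext a
    simp only [Set.mem_ofPred_eq, Set.mem_inter_iff, Set.mem_iInter]
    rw [eq_comm, Tuple.eq_sort_iff]
    rfl
  rw [h]
  refine MeasurableSet.inter ?_ ?_
  · exact MeasurableSet.iInter fun i => MeasurableSet.iInter fun j => MeasurableSet.iInter fun _ =>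
      measurableSet_le (hg _) (hg _)
  · refine MeasurableSet.iInter fun i => MeasurableSet.iInter fun j =>
      MeasurableSet.iInter fun _ => ?_
    -- `σ i < σ j` does not depend on the point: the condition is either void or says that the two
    -- values differ.
    by_cases hij : σ i < σ j
    · simp [hij]
    · simp only [hij, imp_false]
      exact (measurableSet_eq_fun (hg (σ i)) (hg (σ j))).compl

/-! ### The nearest-neighbour estimator -/

section Knn

variable {E F : Type*} [NormedAddCommGroup E]

lemma knnRegression_eq (φ : F → ℝ) {k m : ℕ} (hkm : k ≤ m) (x' : Fin m → E) (y' : Fin m → F)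
    (x : E) :
    knnRegression φ k x' y' x
      = (1 / (k : ℝ)) * ∑ l : Fin k, φ (y' (neighborIndex x' x (Fin.castLE hkm l))) := by
  rw [knnRegression, sum_filter_val_lt hkm (fun l => φ (y' (neighborIndex x' x l)))]

/-- The estimator jumps where the ordering changes, but on each of the finitely many events with a
given ordering it is a fixed measurable expression. -/
lemma measurable_knnRegression [MeasurableSpace E] [BorelSpace E] [SecondCountableTopology E]
    [MeasurableSpace F]
    {φ : F → ℝ} (hφ : Measurable φ) (k m : ℕ) {α : Type*} [MeasurableSpace α]
    {x' : α → Fin m → E} {y' : α → Fin m → F} {x : α → E} (hx' : ∀ j, Measurable fun a => x' a j)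
    (hy' : ∀ j, Measurable fun a => y' a j) (hx : Measurable x) :
    Measurable fun a => knnRegression φ k (x' a) (y' a) (x a) := by
  classical
  have h : (fun a => knnRegression φ k (x' a) (y' a) (x a)) = fun a =>
      ∑ σ : Equiv.Perm (Fin m), Set.indicator {a | Tuple.sort (fun j => ‖x a - x' a j‖) = σ}
        (fun a => (1 / (k : ℝ)) *
          ∑ l ∈ Finset.univ.filter (fun l : Fin m => (l : ℕ) < k), φ (y' a (σ l))) a := by
    ext a
    simp only [Set.indicator_apply, Set.mem_ofPred_eq]
    rw [Finset.sum_ite_eq]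
    simp [knnRegression, neighborIndex]
  rw [h]
  refine Finset.measurable_sum _ fun σ _ => Measurable.indicator ?_ ?_
  · exact (Finset.measurable_sum _ fun l _ => hφ.comp (hy' _)).const_mul _
  · exact measurableSet_sort_eq (fun j => (hx.sub (hx' j)).norm) σ

lemma abs_knnRegression_le {φ : F → ℝ} {B : ℝ} (hB : ∀ y, |φ y| ≤ B) {k m : ℕ} (hk : 1 ≤ k)
    (hkm : k ≤ m) (x' : Fin m → E) (y' : Fin m → F) (x : E) :
    |knnRegression φ k x' y' x| ≤ B := by
  have hk' : (0 : ℝ) < k := by exact_mod_cast hk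
  rw [knnRegression_eq φ hkm, abs_mul, abs_of_pos (by positivity), one_div,
    inv_mul_le_iff₀ hk']
  refine (Finset.abs_sum_le_sum_abs _ _).trans ((Finset.sum_le_sum fun l _ => hB _).trans ?_)
  simp

/-- The mean of a monotone function of the distances to the `k` nearest neighbours is at most its
mean over the nearest neighbours in `k` disjoint blocks of the sample. -/
lemma sum_neighborIndex_le_sum_blocks {m k M : ℕ} (hkm : k ≤ m) {G : ℝ → ℝ} (hG : Monotone G)
    (ι : Fin k × Fin M ↪ Fin m) (hM : (Finset.univ : Finset (Fin M)).Nonempty)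
    (x' : Fin m → E) (x : E) :
    ∑ l : Fin k, G ‖x - x' (neighborIndex x' x (Fin.castLE hkm l))‖
      ≤ ∑ b : Fin k, G (Finset.univ.inf' hM fun s => ‖x - x' (ι (b, s))‖) := by
  have hex : ∀ b : Fin k, ∃ s : Fin M,
      (Finset.univ.inf' hM fun s => ‖x - x' (ι (b, s))‖) = ‖x - x' (ι (b, s))‖ := by
    intro b
    obtain ⟨s, -, hs⟩ := Finset.exists_mem_eq_inf' hM (fun s => ‖x - x' (ι (b, s))‖)
    exact ⟨s, hs⟩
  choose s hs using hex
  have hmono : Monotone fun l => G ‖x - x' (neighborIndex x' x l)‖ :=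
    hG.comp (Tuple.monotone_sort fun j => ‖x - x' j‖)
  -- The chosen points lie in disjoint blocks, so their ranks are distinct.
  have hinj : Function.Injective fun b : Fin k => (neighborIndex x' x).symm (ι (b, s b)) := by
    intro b b' hb
    simpa using congrArg Prod.fst (ι.injective ((neighborIndex x' x).symm.injective hb))
  refine (sum_castLE_le_sum_of_injective hkm hmono hinj).trans (le_of_eq ?_)
  exact Finset.sum_congr rfl fun b _ => by simp [hs b]

end Knn

/-! ### Variance of means of independent bounded variables -/

/-- Mean square deviation from `a` of the mean of `k` independent bounded variables. -/
lemma integral_sq_mean_sub_le {T : Type*} [MeasurableSpace T] (μ : Measure T)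
    [IsProbabilityMeasure μ] {m k : ℕ} (hk : 1 ≤ k) {u : Fin m → T → ℝ}
    (hu : ∀ j, Measurable (u j)) {B : ℝ} (hB : ∀ j t, |u j t| ≤ B) {c : Fin k → Fin m}
    (hc : Function.Injective c) (a : ℝ) :
    ∫ θ, ((1 / (k : ℝ)) * ∑ l, u (c l) (θ (c l)) - a) ^ 2 ∂(Measure.pi fun _ : Fin m => μ)
      ≤ B ^ 2 / k + ((1 / (k : ℝ)) * ∑ l, ∫ t, u (c l) t ∂μ - a) ^ 2 := by
  have hk' : (0 : ℝ) < k := by exact_mod_cast hk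
  set ν := Measure.pi fun _ : Fin m => μ with hν
  have hmem : ∀ l : Fin k, MemLp (fun θ : Fin m → T => u (c l) (θ (c l))) 2 ν := fun l =>
    MemLp.of_bound ((hu _).comp (measurable_pi_apply _)).aestronglyMeasurable B
      (Eventually.of_forall fun θ => hB _ _)
  have hind : ∀ l l' : Fin k, l ≠ l' →
      IndepFun (fun θ : Fin m → T => u (c l) (θ (c l))) (fun θ => u (c l') (θ (c l'))) ν :=
    fun l l' hl => (iIndepFun_pi (μ := fun _ : Fin m => μ) (X := u)
      fun j => (hu j).aemeasurable).indepFun (hc.ne hl)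
  -- A variable with values in `[-B, B]` has variance at most the squared half-length `B ^ 2`.
  have hvar : Var[∑ l, fun θ : Fin m → T => u (c l) (θ (c l)); ν] ≤ k * B ^ 2 := by
    rw [IndepFun.variance_sum (fun l _ => hmem l) (fun l _ l' _ hl => hind l l' hl)]
    refine (Finset.sum_le_sum fun l _ => (variance_le_sq_of_bounded (a := -B) (b := B)
      (Eventually.of_forall fun θ => ⟨neg_le_of_abs_le (hB _ _), le_of_abs_le (hB _ _)⟩)
      (hmem l).aemeasurable)).trans (le_of_eq ?_)
    simp
  have hS : MemLp (fun θ : Fin m → T => (1 / (k : ℝ)) * ∑ l, u (c l) (θ (c l))) 2 ν :=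
    (memLp_finsetSum _ fun l _ => hmem l).const_mul _
  have hSa := hS.sub (memLp_const a)
  have h1 := variance_eq_sub hSa
  have h2 : Var[(fun θ : Fin m → T => (1 / (k : ℝ)) * ∑ l, u (c l) (θ (c l))) - fun _ => a; ν]
      ≤ B ^ 2 / k := by
    have h3 := variance_sub_const hS.aestronglyMeasurable a
    refine (le_of_eq h3).trans ?_
    rw [variance_const_mul]
    have h4 : (fun θ : Fin m → T => ∑ l, u (c l) (θ (c l)))
        = ∑ l, fun θ : Fin m → T => u (c l) (θ (c l)) := by
      ext θ; simp
    rw [h4]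
    calc (1 / (k : ℝ)) ^ 2 * _ ≤ (1 / (k : ℝ)) ^ 2 * (k * B ^ 2) := by gcongr
      _ = _ := by field_simp
  have h5 : ∫ θ, ((fun θ : Fin m → T => (1 / (k : ℝ)) * ∑ l, u (c l) (θ (c l))) -
      fun _ => a : (Fin m → T) → ℝ) θ ∂ν
      = (1 / (k : ℝ)) * ∑ l, ∫ t, u (c l) t ∂μ - a := by
    simp only [Pi.sub_apply]
    rw [integral_sub (hS.integrable one_le_two) (integrable_const _), integral_const_mul,
      integral_finsetSum _ fun l _ => (hmem l).integrable one_le_two]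
    simp only [integral_const, measureReal_def, measure_univ, ENNReal.toReal_one, smul_eq_mul,
      one_mul]
    congr 2
    refine Finset.sum_congr rfl fun l _ => ?_
    exact integral_comp_eval (μ := fun _ : Fin m => μ) (i := c l) (hu _).aestronglyMeasurable
  rw [h5] at h1
  simp only [Pi.pow_apply, Pi.sub_apply] at h1
  linarith

/-- Mean square deviation of the empirical mean of a bounded function from its expectation. -/
lemma integral_sq_mean_sub_integral_le {Ω E : Type*} [MeasurableSpace Ω] [MeasurableSpace E]
    {P : Measure Ω} [IsProbabilityMeasure P] {μ : Measure E} {X : ℕ → Ω → E}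
    (hX : ∀ i, Measurable (X i)) (hlaw : ∀ i, P.map (X i) = μ) (hind : iIndepFun X P)
    {g : E → ℝ} (hg : Measurable g) {B : ℝ} (hB : ∀ x, |g x| ≤ B) {n : ℕ} (hn : 1 ≤ n) :
    ∫ ω, (∫ x, g x ∂μ - (1 / (n : ℝ)) * ∑ i : Fin n, g (X i ω)) ^ 2 ∂P ≤ B ^ 2 / n := by
  have hn' : (0 : ℝ) < n := by exact_mod_cast hn
  have hmem : ∀ i : Fin n, MemLp (fun ω => g (X i ω)) 2 P := fun i =>
    MemLp.of_bound (hg.comp (hX _)).aestronglyMeasurable B (Eventually.of_forall fun ω => hB _)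
  have hi : ∀ i i' : Fin n, i ≠ i' → IndepFun (fun ω => g (X i ω)) (fun ω => g (X i' ω)) P :=
    fun i i' h => (hind.indepFun (Fin.val_ne_of_ne h)).comp hg hg
  have hvar : Var[∑ i : Fin n, fun ω => g (X i ω); P] ≤ n * B ^ 2 := by
    rw [IndepFun.variance_sum (fun l _ => hmem l) (fun l _ l' _ hl => hi l l' hl)]
    refine (Finset.sum_le_sum fun l _ => (variance_le_sq_of_bounded (a := -B) (b := B)
      (Eventually.of_forall fun θ => ⟨neg_le_of_abs_le (hB _), le_of_abs_le (hB _)⟩)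
      (hmem l).aemeasurable)).trans (le_of_eq ?_)
    simp
  have hS : MemLp (fun ω => (1 / (n : ℝ)) * ∑ i : Fin n, g (X i ω)) 2 P :=
    (memLp_finsetSum _ fun l _ => hmem l).const_mul _
  have hmean : ∫ ω, (1 / (n : ℝ)) * ∑ i : Fin n, g (X i ω) ∂P = ∫ x, g x ∂μ := by
    rw [integral_const_mul, integral_finsetSum _ fun l _ => (hmem l).integrable one_le_two]
    have : ∀ i : Fin n, ∫ ω, g (X i ω) ∂P = ∫ x, g x ∂μ := fun i => by
      rw [← hlaw i, integral_map (hX i).aemeasurable hg.aestronglyMeasurable]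
    simp only [this, Finset.sum_const, Finset.card_univ, Fintype.card_fin, nsmul_eq_mul]
    field_simp
  have h1 := variance_eq_integral hS.aemeasurable
  rw [hmean] at h1
  calc _ = ∫ ω, ((1 / (n : ℝ)) * ∑ i : Fin n, g (X i ω) - ∫ x, g x ∂μ) ^ 2 ∂P := by
        congr 1; ext ω; ring
    _ = Var[fun ω => (1 / (n : ℝ)) * ∑ i : Fin n, g (X i ω); P] := h1.symm
    _ = (1 / (n : ℝ)) ^ 2 * Var[∑ i : Fin n, fun ω => g (X i ω); P] := by
        rw [variance_const_mul]
        congr 2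
        ext θ; simp
    _ ≤ (1 / (n : ℝ)) ^ 2 * (n * B ^ 2) := by gcongr
    _ = _ := by field_simp

/-! ### Distance to the nearest point of a block -/

section NearestNeighbor

variable {E : Type*} [NormedAddCommGroup E] [MeasurableSpace E] [BorelSpace E]

lemma measurable_inf'_norm_sub [SecondCountableTopology E] {m M : ℕ} (J : Fin M ↪ Fin m)
    (hM : (Finset.univ : Finset (Fin M)).Nonempty) (x : E) :
    Measurable fun y : Fin m → E => Finset.univ.inf' hM fun s => ‖x - y (J s)‖ := by
  have : (fun y : Fin m → E => Finset.univ.inf' hM fun s => ‖x - y (J s)‖)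
      = Finset.univ.inf' hM fun s => fun y : Fin m → E => ‖x - y (J s)‖ := by
    ext y; simp [Finset.inf'_apply]
  rw [this]
  exact Finset.inf'_induction hM _ (fun f hf g hg => Measurable.inf hf hg)
    fun s _ => (measurable_const.sub (measurable_pi_apply _)).norm

/-- The minimum exceeds `t` exactly when all `M` independent points avoid the closed ball of radius
`t`. -/
lemma measure_pi_lt_inf'_norm_sub (μ : Measure E) [IsProbabilityMeasure μ] {m M : ℕ}
    (J : Fin M ↪ Fin m) (hM : (Finset.univ : Finset (Fin M)).Nonempty) (x : E) (t : ℝ) :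
    (Measure.pi fun _ : Fin m => μ) {y | t < Finset.univ.inf' hM fun s => ‖x - y (J s)‖}
      = (1 - μ (Metric.closedBall x t)) ^ M := by
  have h : {y : Fin m → E | t < Finset.univ.inf' hM fun s => ‖x - y (J s)‖}
      = Set.pi ((Finset.univ.map J : Finset (Fin m)) : Set (Fin m))
        fun _ => (Metric.closedBall x t)ᶜ := by
    ext y
    simp [Finset.lt_inf'_iff, Set.mem_pi, dist_comm _ x, dist_eq_norm]
  rw [h, Measure.pi_pi_finset, Finset.prod_const, Finset.card_map,
    prob_compl_eq_one_sub Metric.isClosed_closedBall.measurableSet]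
  simp

lemma one_sub_pow_le_ofReal_exp {a : ℝ≥0∞} {b : ℝ} (hb : ENNReal.ofReal b ≤ a)
    (ha : a ≤ 1) (M : ℕ) : (1 - a) ^ M ≤ ENNReal.ofReal (Real.exp (-(M * b))) := by
  have h : 1 - a ≤ ENNReal.ofReal (Real.exp (-b)) := by
    have hfin : a ≠ ⊤ := ne_top_of_le_ne_top ENNReal.one_ne_top ha
    refine tsub_le_iff_right.2 ?_
    rw [← ENNReal.ofReal_toReal hfin, ← ENNReal.ofReal_add (Real.exp_pos _).le
      ENNReal.toReal_nonneg, ← ENNReal.ofReal_one]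
    refine ENNReal.ofReal_le_ofReal ?_
    have h1 := Real.add_one_le_exp (-b)
    have h2 : b ≤ a.toReal := (ENNReal.ofReal_le_iff_le_toReal hfin).1 hb
    linarith
  calc (1 - a) ^ M ≤ (ENNReal.ofReal (Real.exp (-b))) ^ M := pow_le_pow_left' h M
    _ = _ := by
      rw [← ENNReal.ofReal_pow (Real.exp_pos _).le, ← Real.exp_nat_mul]
      congr 2; ring

/-- Truncated second moment of the distance from `x` to the nearest of `M` sample points, if the
balls around `x` have mass at least `q r ^ d`. -/
lemma lintegral_sq_min_nearest_le [SecondCountableTopology E]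
    (μ : Measure E) [IsProbabilityMeasure μ] {m M d : ℕ} (hd : 1 ≤ d)
    (J : Fin M ↪ Fin m) (hM : (Finset.univ : Finset (Fin M)).Nonempty) (x : E) {q r : ℝ}
    (hq : 0 < q) (hr : 0 < r)
    (hball : ∀ t : ℝ, 0 ≤ t → t ≤ r → ENNReal.ofReal (q * t ^ d) ≤ μ (Metric.closedBall x t)) :
    ∫⁻ y, ENNReal.ofReal ((min (Finset.univ.inf' hM fun s => ‖x - y (J s)‖) r) ^ 2)
        ∂(Measure.pi fun _ : Fin m => μ)
      ≤ ENNReal.ofReal (2 * ((M * q) ^ (-(2 / (d : ℝ))) * (1 / d) * Real.Gamma (2 / d))) := by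
  have hd' : (0 : ℝ) < d := by exact_mod_cast hd
  have hM' : (0 : ℝ) < M := by
    obtain ⟨s, -⟩ := hM
    exact_mod_cast s.pos
  set D : (Fin m → E) → ℝ := fun y => Finset.univ.inf' hM fun s => ‖x - y (J s)‖ with hD
  have hDm : Measurable D := measurable_inf'_norm_sub J hM x
  have hD0 : ∀ y, 0 ≤ D y := fun y => Finset.le_inf' _ _ fun s _ => norm_nonneg _
  -- Layer-cake formula: the second moment is twice the integral of `t` times the tail probability
  -- at `t`.
  have h0 := lintegral_rpow_eq_lintegral_meas_lt_mul (Measure.pi fun _ : Fin m => μ)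
    (f := fun y => min (D y) r) (Eventually.of_forall fun y => le_min (hD0 y) hr.le)
    (hDm.min measurable_const).aemeasurable (p := 2) two_pos
  simp only [Real.rpow_two] at h0
  rw [h0]
  have hint := integrableOn_rpow_mul_exp_neg_mul_rpow (p := d) (s := 1) (b := M * q)
    (by norm_num) hd' (by positivity)
  have hgam := integral_rpow_mul_exp_neg_mul_rpow (p := d) (q := 1) (b := M * q) hd'
    (by norm_num) (by positivity)
  have hle : ∫⁻ t in Set.Ioi (0 : ℝ), (Measure.pi fun _ : Fin m => μ) {y | t < min (D y) r}
        * ENNReal.ofReal (t ^ ((2 : ℝ) - 1))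
      ≤ ∫⁻ t in Set.Ioi (0 : ℝ),
        ENNReal.ofReal (t ^ (1 : ℝ) * Real.exp (-(M * q) * t ^ (d : ℝ))) := by
    refine setLIntegral_mono' measurableSet_Ioi fun t ht => ?_
    have ht : 0 < t := ht
    norm_num
    rw [mul_comm, ENNReal.ofReal_mul ht.le]
    gcongr
    -- The truncated distance never exceeds `r`, so the mass bound is needed only for `t < r`, where
    -- it is available.
    rcases lt_or_ge t r with htr | htr
    · calc _ ≤ (Measure.pi fun _ : Fin m => μ) {y | t < D y} :=
            measure_mono fun y hy => hy.1
        _ = (1 - μ (Metric.closedBall x t)) ^ M := measure_pi_lt_inf'_norm_sub μ J hM x t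
        _ ≤ _ := one_sub_pow_le_ofReal_exp (hball t ht.le htr.le) prob_le_one M
        _ = _ := by congr 2; ring
    · have : {a | t < D a ∧ t < r} = ∅ := by
        ext a; simp [htr]
      simp [this]
  calc _ ≤ ENNReal.ofReal 2 * _ := mul_le_mul_right hle _
    _ = ENNReal.ofReal 2 * ENNReal.ofReal _ := by
      rw [← ofReal_integral_eq_lintegral_ofReal hint]
      exact (ae_restrict_mem measurableSet_Ioi).mono fun t ht => by
        have ht : 0 < t := ht
        positivity
    _ = _ := by
      rw [← ENNReal.ofReal_mul two_pos.le, hgam]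
      norm_num [neg_div]

end NearestNeighbor

/-! ### Joint law of an evaluation point and the training sample -/

lemma IsCovariateShiftSample.map_prod_eq {Ω E T : Type*} [MeasurableSpace Ω] [MeasurableSpace E]
    [MeasurableSpace T] {P : Measure Ω} [IsProbabilityMeasure P] {μX μX' : Measure E}
    {μΘ : Measure T} [IsProbabilityMeasure μX'] [IsProbabilityMeasure μΘ]
    {X X' : ℕ → Ω → E} {Θ : ℕ → Ω → T}
    (h : IsCovariateShiftSample P μX μX' μΘ X X' Θ) (i m : ℕ) :
    P.map (fun ω => (X i ω, ((fun j : Fin m => X' j ω), (fun j : Fin m => Θ j ω))))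
      = μX.prod ((Measure.pi fun _ : Fin m => μX').prod (Measure.pi fun _ : Fin m => μΘ)) := by
  have hX := h.measurable_X
  have hX' := h.measurable_X'
  have hΘ := h.measurable_Θ
  have h1 : IndepFun (X i)
      (fun ω => ((fun j : Fin m => X' j ω), (fun j : Fin m => Θ j ω))) P :=
    h.indep_samples.comp (φ := fun z : ℕ → E => z i)
      (ψ := fun z : ℕ → E × T => ((fun j : Fin m => (z j).1), (fun j : Fin m => (z j).2)))
      (by fun_prop) (by fun_prop)
  rw [(indepFun_iff_map_prod_eq_prod_map_map (by fun_prop) (by fun_prop)).1 h1, h.law_X]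
  congr 1
  have h2 : iIndepFun (fun (j : Fin m) ω => (X' j ω, Θ j ω)) P :=
    h.indep_pairs.precomp Fin.val_injective
  have h3 := (iIndepFun_iff_map_fun_eq_pi_map (by fun_prop)).1 h2
  have h4 : ∀ j : Fin m, P.map (fun ω => (X' j ω, Θ j ω)) = μX'.prod μΘ := fun j => by
    rw [(indepFun_iff_map_prod_eq_prod_map_map (by fun_prop) (by fun_prop)).1 (h.indep_X'_Θ j),
      h.law_X', h.law_Θ]
  simp only [h4] at h3
  have h5 := (measurePreserving_arrowProdEquivProdArrow E T (Fin m) (fun _ => μX')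
    (fun _ => μΘ)).map_eq
  rw [← h5, ← h3, Measure.map_map (MeasurableEquiv.measurable _) (by fun_prop)]
  rfl

/-! ### Bias and variance at a point -/

/-- The squared bias of the nearest-neighbour regression is at most the mean, over `k` disjoint
blocks of the sample, of the squared truncated distance to the nearest point of the block. -/
lemma sq_mean_neighborIndex_sub_le {E : Type*} [NormedAddCommGroup E] {ψ : E → ℝ} {c r : ℝ}
    (hr : 0 < r) (hosc : ∀ a b, |ψ a - ψ b| ≤ c * min ‖a - b‖ r) {k m M : ℕ} (hk : 1 ≤ k)
    (hkm : k ≤ m) (ι : Fin k × Fin M ↪ Fin m) (hM : (Finset.univ : Finset (Fin M)).Nonempty)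
    (y : Fin m → E) (x : E) :
    ((1 / (k : ℝ)) * ∑ l : Fin k, ψ (y (neighborIndex y x (Fin.castLE hkm l))) - ψ x) ^ 2
      ≤ (1 / (k : ℝ)) *
        ∑ b, c ^ 2 * (min (Finset.univ.inf' hM fun s => ‖x - y (ι (b, s))‖) r) ^ 2 := by
  have hk' : (0 : ℝ) < k := by exact_mod_cast hk
  -- `max t 0` makes `G` monotone on all of `ℝ`; distances are unaffected.
  let G : ℝ → ℝ := fun t => c ^ 2 * (min (max t 0) r) ^ 2
  have hG : Monotone G := fun s t hst => by
    have : 0 ≤ min (max s 0) r := le_min (le_max_right _ _) hr.le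
    simp only [G]
    gcongr
  have h1 := sum_neighborIndex_le_sum_blocks hkm hG ι hM y x
  simp only [G, max_eq_left (norm_nonneg _)] at h1
  have h2 : ∀ b, max (Finset.univ.inf' hM fun s => ‖x - y (ι (b, s))‖) 0
      = Finset.univ.inf' hM fun s => ‖x - y (ι (b, s))‖ :=
    fun b => max_eq_left (Finset.le_inf' _ _ fun s _ => norm_nonneg _)
  simp only [h2] at h1
  calc ((1 / (k : ℝ)) * ∑ l : Fin k, ψ (y (neighborIndex y x (Fin.castLE hkm l))) - ψ x) ^ 2
      = (1 / (k : ℝ)) ^ 2 *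
        (∑ l : Fin k, (ψ (y (neighborIndex y x (Fin.castLE hkm l))) - ψ x)) ^ 2 := by
        rw [Finset.sum_sub_distrib]
        simp only [Finset.sum_const, Finset.card_univ, Fintype.card_fin, nsmul_eq_mul]
        field_simp
    _ ≤ (1 / (k : ℝ)) ^ 2 *
        (k * ∑ l : Fin k, (ψ (y (neighborIndex y x (Fin.castLE hkm l))) - ψ x) ^ 2) := by
        gcongr
        simpa using sq_sum_le_card_mul_sum_sq (s := (Finset.univ : Finset (Fin k)))
          (f := fun l => ψ (y (neighborIndex y x (Fin.castLE hkm l))) - ψ x)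
    _ = (1 / (k : ℝ)) *
        ∑ l : Fin k, (ψ (y (neighborIndex y x (Fin.castLE hkm l))) - ψ x) ^ 2 := by
        field_simp
    _ ≤ (1 / (k : ℝ)) *
        ∑ l : Fin k, c ^ 2 * (min ‖x - y (neighborIndex y x (Fin.castLE hkm l))‖ r) ^ 2 := by
        gcongr with l
        rw [← mul_pow, ← sq_abs, norm_sub_rev]
        exact pow_le_pow_left₀ (abs_nonneg _) (hosc _ _) 2
    _ ≤ _ := by gcongr

/-- Conditionally on the covariates, the mean square error of the nearest-neighbour regression is at
most the sum of a variance term and of the squared bias. -/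
lemma lintegral_sq_sub_knnRegression_le_bias {E : Type*} [NormedAddCommGroup E]
    [MeasurableSpace E] {T F : Type*} [MeasurableSpace T] [MeasurableSpace F]
    {f : E × T → F} (hf : Measurable f) {φ : F → ℝ} (hφ : Measurable φ)
    (ν : Measure T) [IsProbabilityMeasure ν] {B : ℝ} (hB : ∀ y, |φ y| ≤ B)
    {k m : ℕ} (hk : 1 ≤ k) (hkm : k ≤ m) (y : Fin m → E) (x : E) (a : ℝ) :
    ∫⁻ θ, ENNReal.ofReal ((a - knnRegression φ k y (fun j => f (y j, θ j)) x) ^ 2)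
        ∂(Measure.pi fun _ : Fin m => ν)
      ≤ ENNReal.ofReal (B ^ 2 / k + ((1 / (k : ℝ)) * ∑ l : Fin k,
        ∫ t, φ (f (y (neighborIndex y x (Fin.castLE hkm l)), t)) ∂ν - a) ^ 2) := by
  have hu : ∀ j, Measurable fun t => φ (f (y j, t)) := fun j => by fun_prop
  have h2 : ∀ θ : Fin m → T, (a - knnRegression φ k y (fun j => f (y j, θ j)) x) ^ 2
      = ((1 / (k : ℝ)) * ∑ l : Fin k, φ (f (y (neighborIndex y x (Fin.castLE hkm l)),
        θ (neighborIndex y x (Fin.castLE hkm l)))) - a) ^ 2 := fun θ => by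
    rw [knnRegression_eq φ hkm]; ring
  have hm : Measurable fun θ : Fin m → T =>
      (a - knnRegression φ k y (fun j => f (y j, θ j)) x) ^ 2 := by
    simp only [h2]
    fun_prop
  rw [← ofReal_integral_eq_lintegral_ofReal _ (Eventually.of_forall fun θ => sq_nonneg _)]
  · refine ENNReal.ofReal_le_ofReal ?_
    simp only [h2]
    -- The ordering depends on `y` alone, so with `y` fixed the `k` selected noises are independent.
    exact integral_sq_mean_sub_le ν hk hu (fun j t => hB _)
      (c := fun l => neighborIndex y x (Fin.castLE hkm l)) (fun l l' hl => by simpa using hl) a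
  · refine Integrable.of_bound hm.aestronglyMeasurable ((|a| + B) ^ 2)
      (Eventually.of_forall fun θ => ?_)
    rw [norm_pow, Real.norm_eq_abs]
    refine pow_le_pow_left₀ (abs_nonneg _) ((abs_sub _ _).trans ?_) 2
    gcongr
    exact abs_knnRegression_le hB hk hkm _ _ _

/-- Mean square error at a point of the nearest-neighbour regression, when the oscillation of the
regression function is controlled by the truncated distance. -/
lemma lintegral_sq_sub_knnRegression_le {E : Type*} [NormedAddCommGroup E] [MeasurableSpace E]
    [BorelSpace E] [SecondCountableTopology E] {T F : Type*} [MeasurableSpace T]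
    [MeasurableSpace F]
    {f : E × T → F} (hf : Measurable f) {φ : F → ℝ} (hφ : Measurable φ)
    (μ : Measure E) [IsProbabilityMeasure μ] (ν : Measure T) [IsProbabilityMeasure ν]
    {B : ℝ} (hB : ∀ y, |φ y| ≤ B) {c r : ℝ} (hr : 0 < r)
    (hosc : ∀ a b, |(∫ θ, φ (f (a, θ)) ∂ν) - ∫ θ, φ (f (b, θ)) ∂ν| ≤ c * min ‖a - b‖ r)
    {d k m : ℕ} (hd : 1 ≤ d) (hk : 1 ≤ k) (hkm : k ≤ m) {q : ℝ} (hq : 0 < q) (x : E)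
    (hball : ∀ t : ℝ, 0 ≤ t → t ≤ r → ENNReal.ofReal (q * t ^ d) ≤ μ (Metric.closedBall x t)) :
    ∫⁻ z, ENNReal.ofReal (((∫ θ, φ (f (x, θ)) ∂ν) -
        knnRegression φ k z.1 (fun j => f (z.1 j, z.2 j)) x) ^ 2)
        ∂((Measure.pi fun _ : Fin m => μ).prod (Measure.pi fun _ : Fin m => ν))
      ≤ ENNReal.ofReal (B ^ 2 / k + c ^ 2 *
        (2 * ((((m / k : ℕ) : ℝ) * q) ^ (-(2 / (d : ℝ))) * (1 / d) * Real.Gamma (2 / d)))) := by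
  have hk' : (0 : ℝ) < k := by exact_mod_cast hk
  have hd' : (0 : ℝ) < d := by exact_mod_cast hd
  have hM1 : 0 < m / k := Nat.div_pos hkm hk
  have hM : (Finset.univ : Finset (Fin (m / k))).Nonempty := ⟨⟨0, hM1⟩, Finset.mem_univ _⟩
  -- The first `k * (m / k)` indices, cut into `k` blocks; the remainder of the division is dropped.
  let ι : Fin k × Fin (m / k) ↪ Fin m :=
    finProdFinEquiv.toEmbedding.trans (Fin.castLEEmb (Nat.mul_div_le m k))
  let J : Fin k → Fin (m / k) ↪ Fin m := fun b =>
    ⟨fun s => ι (b, s), fun s s' hs => by simpa using ι.injective hs⟩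
  set ψ : E → ℝ := fun x => ∫ θ, φ (f (x, θ)) ∂ν with hψ
  set K := 2 * ((((m / k : ℕ) : ℝ) * q) ^ (-(2 / (d : ℝ))) * (1 / d) * Real.Gamma (2 / d)) with hK
  have hK0 : 0 ≤ K := by
    have := Real.Gamma_pos_of_pos (show 0 < 2 / (d : ℝ) by positivity)
    positivity
  let D : Fin k → (Fin m → E) → ℝ := fun b y => Finset.univ.inf' hM fun s => ‖x - y (J b s)‖
  have hDm : ∀ b, Measurable (D b) := fun b => measurable_inf'_norm_sub (J b) hM x
  have hmeas : Measurable fun z : (Fin m → E) × (Fin m → T) =>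
      (ψ x - knnRegression φ k z.1 (fun j => f (z.1 j, z.2 j)) x) ^ 2 :=
    (measurable_const.sub (measurable_knnRegression (x := fun _ => x) hφ k m (by fun_prop)
      (by fun_prop) measurable_const)).pow_const 2
  have hinner : ∀ y : Fin m → E, ∫⁻ θ, ENNReal.ofReal ((ψ x -
      knnRegression φ k y (fun j => f (y j, θ j)) x) ^ 2) ∂(Measure.pi fun _ : Fin m => ν)
      ≤ ENNReal.ofReal (B ^ 2 / k) +
        ∑ b, ENNReal.ofReal ((1 / (k : ℝ)) * c ^ 2) * ENNReal.ofReal ((min (D b y) r) ^ 2) := by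
    intro y
    refine (lintegral_sq_sub_knnRegression_le_bias hf hφ ν hB hk hkm y x (ψ x)).trans ?_
    refine (ENNReal.ofReal_le_ofReal (add_le_add_right
      (sq_mean_neighborIndex_sub_le hr hosc hk hkm ι hM y x) _)).trans ?_
    rw [ENNReal.ofReal_add (by positivity) (by positivity), Finset.mul_sum,
      ENNReal.ofReal_sum_of_nonneg fun b _ => by positivity]
    gcongr with b
    rw [← ENNReal.ofReal_mul (by positivity), mul_assoc]
    rfl
  rw [lintegral_prod _ hmeas.ennreal_ofReal.aemeasurable]
  refine (lintegral_mono hinner).trans ?_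
  rw [lintegral_add_left measurable_const, lintegral_finsetSum _ fun b _ =>
    (((hDm b).min measurable_const).pow_const 2).ennreal_ofReal.const_mul _]
  have hb : ∀ b, ∫⁻ y, ENNReal.ofReal ((1 / (k : ℝ)) * c ^ 2) *
      ENNReal.ofReal ((min (D b y) r) ^ 2) ∂(Measure.pi fun _ : Fin m => μ)
      ≤ ENNReal.ofReal ((1 / (k : ℝ)) * c ^ 2 * K) := fun b => by
    rw [lintegral_const_mul _ (((hDm b).min measurable_const).pow_const 2).ennreal_ofReal,
      ENNReal.ofReal_mul (by positivity : 0 ≤ (1 / (k : ℝ)) * c ^ 2)]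
    gcongr
    exact lintegral_sq_min_nearest_le μ hd (J b) hM x hq hr hball
  refine (add_le_add le_rfl (Finset.sum_le_sum fun b _ => hb b)).trans (le_of_eq ?_)
  rw [← ENNReal.ofReal_sum_of_nonneg fun b _ => by positivity, lintegral_const, measure_univ,
    mul_one, ← ENNReal.ofReal_add (by positivity) (by positivity)]
  congr 2
  simp only [Finset.sum_const, Finset.card_univ, Fintype.card_fin, nsmul_eq_mul]
  field_simp

/-! ### Choice of the number of neighbours -/

/-- The rates in the bias-variance trade-off for the optimal number of neighbours. -/
lemma exists_neighbors_rate {d : ℕ} (hd : 1 ≤ d) {k : ℕ → ℕ} (hk_pos : ∀ m, 1 ≤ m → 1 ≤ k m)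
    (hk : (fun m : ℕ => (k m : ℝ)) ~[atTop] (fun m : ℕ => (m : ℝ) ^ (2 / ((d : ℝ) + 2)))) :
    ∃ C : ℝ, 0 < C ∧ ∀ m : ℕ, 1 ≤ m → k m ≤ m →
      1 / (k m : ℝ) ≤ C * (1 / (m : ℝ) ^ (1 / ((d : ℝ) + 2))) ^ 2 ∧
      ((m / k m : ℕ) : ℝ) ^ (-(2 / (d : ℝ))) ≤ C * (1 / (m : ℝ) ^ (1 / ((d : ℝ) + 2))) ^ 2 := by
  have hd' : (0 : ℝ) < d := by exact_mod_cast hd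
  -- On `ℕ` an asymptotic bound holds, with a larger constant, at every index where the comparison
  -- function is nonzero.
  obtain ⟨C₁, hC₁, h₁⟩ := bound_of_isBigO_nat_atTop hk.isBigO
  obtain ⟨C₂, hC₂, h₂⟩ := bound_of_isBigO_nat_atTop hk.symm.isBigO
  refine ⟨max C₂ ((2 * C₁) ^ (2 / (d : ℝ))), lt_max_of_lt_left hC₂, fun m hm hkm => ?_⟩
  have hm' : (0 : ℝ) < m := by exact_mod_cast hm
  have hk1 := hk_pos m hm
  have hk' : (0 : ℝ) < k m := by exact_mod_cast hk1
  have hpow : (0 : ℝ) < (m : ℝ) ^ (2 / ((d : ℝ) + 2)) := by positivity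
  have hsq : (1 / (m : ℝ) ^ (1 / ((d : ℝ) + 2))) ^ 2 = 1 / (m : ℝ) ^ (2 / ((d : ℝ) + 2)) := by
    rw [div_pow, one_pow, ← Real.rpow_mul_natCast hm'.le]
    congr 2
    push_cast; ring
  have h₁' := h₁ hpow.ne'
  have h₂' := h₂ (x := m) hk'.ne'
  rw [Real.norm_of_nonneg hpow.le, Real.norm_of_nonneg hk'.le] at h₁' h₂'
  rw [hsq]
  constructor
  · calc 1 / (k m : ℝ) ≤ C₂ * (1 / (m : ℝ) ^ (2 / ((d : ℝ) + 2))) := by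
          rw [mul_one_div, div_le_div_iff₀ hk' hpow]; linarith
      _ ≤ _ := by gcongr; exact le_max_left _ _
  · have hM1 : 0 < m / k m := Nat.div_pos hkm hk1
    -- Rounding down costs at most a factor 2, since the quotient is at least 1.
    have hM : (m : ℝ) ≤ 2 * k m * (m / k m : ℕ) := by
      have : m < k m * (m / k m + 1) := Nat.lt_mul_div_succ m hk1
      have h3 : m ≤ 2 * k m * (m / k m) := by nlinarith [Nat.zero_le (k m)]
      exact_mod_cast h3
    have hM' : (m : ℝ) ^ ((d : ℝ) / (d + 2)) / (2 * C₁) ≤ ((m / k m : ℕ) : ℝ) := by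
      have hsplit : (m : ℝ) ^ ((d : ℝ) / (d + 2)) * (m : ℝ) ^ (2 / ((d : ℝ) + 2)) = m := by
        rw [← Real.rpow_add hm', ← add_div, div_self (by positivity), Real.rpow_one]
      rw [div_le_iff₀ (by positivity)]
      refine le_of_mul_le_mul_right ?_ hpow
      rw [hsplit]
      calc (m : ℝ) ≤ 2 * k m * (m / k m : ℕ) := hM
        _ ≤ 2 * (C₁ * (m : ℝ) ^ (2 / ((d : ℝ) + 2))) * (m / k m : ℕ) := by gcongr
        _ = _ := by ring
    calc ((m / k m : ℕ) : ℝ) ^ (-(2 / (d : ℝ)))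
        ≤ ((m : ℝ) ^ ((d : ℝ) / (d + 2)) / (2 * C₁)) ^ (-(2 / (d : ℝ))) :=
          Real.rpow_le_rpow_of_nonpos (by positivity) hM' (by
            have : 0 < 2 / (d : ℝ) := by positivity
            linarith)
      _ = (2 * C₁) ^ (2 / (d : ℝ)) * (1 / (m : ℝ) ^ (2 / ((d : ℝ) + 2))) := by
          rw [Real.div_rpow (by positivity) (by positivity), ← Real.rpow_mul hm'.le,
            Real.rpow_neg (by positivity : (0 : ℝ) ≤ 2 * C₁),
            show (d : ℝ) / (d + 2) * -(2 / d) = -(2 / ((d : ℝ) + 2)) by field_simp,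
            Real.rpow_neg hm'.le]
          field_simp
      _ ≤ _ := by gcongr; exact le_max_right _ _

/-! ### Error of the regression averaged over the evaluation law -/

lemma quantityOfInterest_eq_integral {E T F : Type*} [MeasurableSpace E] [MeasurableSpace T]
    [MeasurableSpace F] (μX : Measure E) [IsProbabilityMeasure μX] (μΘ : Measure T)
    [IsProbabilityMeasure μΘ] {f : E × T → F} (hf : Measurable f) {φ : F → ℝ} (hφ : Measurable φ)
    {B : ℝ} (hB : ∀ y, |φ y| ≤ B) :
    quantityOfInterest μX μΘ f φ = ∫ x, ∫ θ, φ (f (x, θ)) ∂μΘ ∂μX := by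
  rw [quantityOfInterest, integral_map hf.aemeasurable hφ.aestronglyMeasurable]
  exact integral_prod _ (Integrable.of_bound (hφ.comp hf).aestronglyMeasurable B
    (Eventually.of_forall fun z => hB _))

lemma abs_integral_le_of_abs_le {α : Type*} [MeasurableSpace α] (μ : Measure α)
    [IsProbabilityMeasure μ] {g : α → ℝ} {B : ℝ} (hB : ∀ a, |g a| ≤ B) :
    |∫ a, g a ∂μ| ≤ B := by
  have := norm_integral_le_of_norm_le_const (μ := μ) (f := g) (C := B)
    (Eventually.of_forall hB)
  simpa using this

lemma abs_estimatedQI_le {E F : Type*} [NormedAddCommGroup E] {φ : F → ℝ} {B : ℝ}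
    (hB : ∀ y, |φ y| ≤ B) {k m n : ℕ} (hk : 1 ≤ k) (hkm : k ≤ m) (hn : 1 ≤ n) (x' : Fin m → E)
    (y' : Fin m → F) (x : Fin n → E) : |estimatedQI φ k x' y' x| ≤ B := by
  have hn' : (0 : ℝ) < n := by exact_mod_cast hn
  rw [estimatedQI, abs_mul, abs_of_pos (by positivity), one_div, inv_mul_le_iff₀ hn']
  refine (Finset.abs_sum_le_sum_abs _ _).trans
    ((Finset.sum_le_sum fun i _ => abs_knnRegression_le hB hk hkm _ _ _).trans ?_)
  simp

/-- A bounded Lipschitz function has its oscillation controlled by any truncation of the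
distance. -/
lemma LipschitzWith.exists_abs_sub_le_mul_min {E : Type*} [NormedAddCommGroup E] {ψ : E → ℝ}
    {L : ℝ≥0} (hψ : LipschitzWith L ψ) {B : ℝ} (hB : ∀ x, |ψ x| ≤ B) {r : ℝ} (hr : 0 < r) :
    ∃ c : ℝ, ∀ a b, |ψ a - ψ b| ≤ c * min ‖a - b‖ r := by
  -- `L` serves distances up to `r`, and `2 * B / r` serves larger ones, where only boundedness is
  -- used.
  refine ⟨max L (2 * B / r), fun a b => ?_⟩
  rcases le_total ‖a - b‖ r with h | h
  · rw [min_eq_left h]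
    have := hψ.dist_le_mul a b
    rw [Real.dist_eq, dist_eq_norm] at this
    exact this.trans (by gcongr; exact le_max_left _ _)
  · rw [min_eq_right h]
    calc |ψ a - ψ b| ≤ |ψ a| + |ψ b| := abs_sub _ _
      _ ≤ 2 * B := by linarith [hB a, hB b]
      _ = 2 * B / r * r := by field_simp
      _ ≤ _ := by gcongr; exact le_max_right _ _

/-- Mean square error of the nearest-neighbour regression under the evaluation distribution. -/
lemma exists_lintegral_sq_sub_knnRegression_le
    {E : Type*} [NormedAddCommGroup E] [NormedSpace ℝ E] [FiniteDimensional ℝ E]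
    [MeasurableSpace E] [BorelSpace E] {d : ℕ} (hd : 1 ≤ d)
    (lam : Measure E) [lam.IsAddHaarMeasure] {T F : Type*} [MeasurableSpace T] [MeasurableSpace F]
    {f : E × T → F} (hf : Measurable f) {φ : F → ℝ} (hφ : Measurable φ)
    (μX μX' : Measure E) [IsProbabilityMeasure μX] [IsProbabilityMeasure μX']
    (μΘ : Measure T) [IsProbabilityMeasure μΘ] {B : ℝ} (hB : ∀ y, |φ y| ≤ B)
    {L : ℝ≥0} (hψ : LipschitzWith L (fun x => ∫ θ, φ (f (x, θ)) ∂μΘ))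
    {U : Set E} {p : E → ℝ} (hsupp : StrongSupportCondition d lam μX μX' U p)
    (hmom : ∫⁻ x, ENNReal.ofReal ((1 + ‖x‖ ^ 2) / p x ^ (2 / (d : ℝ))) ∂μX < ⊤) :
    ∃ A : ℝ, 0 ≤ A ∧ ∀ k m : ℕ, 1 ≤ k → k ≤ m →
      ∫⁻ z, ENNReal.ofReal (((∫ θ, φ (f (z.1, θ)) ∂μΘ) -
        knnRegression φ k z.2.1 (fun j => f (z.2.1 j, z.2.2 j)) z.1) ^ 2)
        ∂(μX.prod ((Measure.pi fun _ : Fin m => μX').prod (Measure.pi fun _ : Fin m => μΘ)))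
      ≤ ENNReal.ofReal (B ^ 2 / k + A * ((m / k : ℕ) : ℝ) ^ (-(2 / (d : ℝ)))) := by
  have hd' : (0 : ℝ) < d := by exact_mod_cast hd
  obtain ⟨κ, hκ, -, r, hr, hball⟩ := hsupp.minimal_mass
  have hψB : ∀ x, |∫ θ, φ (f (x, θ)) ∂μΘ| ≤ B := fun x =>
    abs_integral_le_of_abs_le μΘ fun θ => hB (f (x, θ))
  obtain ⟨c, hc⟩ := hψ.exists_abs_sub_le_mul_min hψB hr
  set v := lam.real (Metric.closedBall (0 : E) 1) with hv
  have hv0 : 0 < v := by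
    rw [hv, measureReal_def]
    exact ENNReal.toReal_pos (Metric.measure_closedBall_pos lam 0 one_pos).ne'
      measure_closedBall_lt_top.ne
  set I := ∫⁻ x, ENNReal.ofReal ((1 + ‖x‖ ^ 2) / p x ^ (2 / (d : ℝ))) ∂μX with hI
  have hΓ := Real.Gamma_pos_of_pos (show 0 < 2 / (d : ℝ) by positivity)
  set A₀ := c ^ 2 * (2 * ((κ * v) ^ (-(2 / (d : ℝ))) * (1 / d) * Real.Gamma (2 / d))) with hA₀
  have hA₀0 : 0 ≤ A₀ := by positivity
  refine ⟨A₀ * I.toReal, by positivity, fun k m hk hkm => ?_⟩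
  set R := ((m / k : ℕ) : ℝ) ^ (-(2 / (d : ℝ))) with hR
  have hR0 : 0 ≤ R := by positivity
  have hmeas : Measurable fun z : E × (Fin m → E) × (Fin m → T) =>
      ENNReal.ofReal (((∫ θ, φ (f (z.1, θ)) ∂μΘ) -
        knnRegression φ k z.2.1 (fun j => f (z.2.1 j, z.2.2 j)) z.1) ^ 2) :=
    (((hψ.continuous.measurable.comp measurable_fst).sub (measurable_knnRegression hφ k m
      (by fun_prop) (by fun_prop) measurable_fst)).pow_const 2).ennreal_ofReal
  rw [lintegral_prod _ hmeas.aemeasurable]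
  have hU : ∀ᵐ x ∂μX, x ∈ U :=
    Filter.mem_of_superset Measure.support_mem_ae hsupp.support_subset
  calc _ ≤ ∫⁻ x, (ENNReal.ofReal (B ^ 2 / k) + ENNReal.ofReal (A₀ * R) *
        ENNReal.ofReal ((1 + ‖x‖ ^ 2) / p x ^ (2 / (d : ℝ)))) ∂μX := by
        refine lintegral_mono_ae (hU.mono fun x hx => ?_)
        have hp := hsupp.pos x hx
        refine (lintegral_sq_sub_knnRegression_le hf hφ μX' μΘ hB hr hc hd hk hkm
          (q := κ * p x * v) (by positivity) x (hball x hx)).trans ?_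
        rw [← ENNReal.ofReal_mul (by positivity), ← ENNReal.ofReal_add (by positivity)
          (by positivity)]
        refine ENNReal.ofReal_le_ofReal (add_le_add_right ?_ _)
        -- The three factors separate: block size, constants of the mass condition, and the density
        -- at `x`, the only one left to integrate.
        have hsplit : (((m / k : ℕ) : ℝ) * (κ * p x * v)) ^ (-(2 / (d : ℝ)))
            = R * (κ * v) ^ (-(2 / (d : ℝ))) * (1 / p x ^ (2 / (d : ℝ))) := by
          rw [show ((m / k : ℕ) : ℝ) * (κ * p x * v) = ((m / k : ℕ) : ℝ) * (κ * v) * p x by ring,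
            Real.mul_rpow (by positivity) hp.le, Real.mul_rpow (by positivity) (by positivity),
            Real.rpow_neg hp.le, one_div]
        rw [hsplit]
        have h1 : 1 / p x ^ (2 / (d : ℝ)) ≤ (1 + ‖x‖ ^ 2) / p x ^ (2 / (d : ℝ)) := by
          gcongr
          nlinarith [sq_nonneg ‖x‖]
        calc _ = A₀ * R * (1 / p x ^ (2 / (d : ℝ))) := by rw [hA₀]; ring
          _ ≤ _ := by gcongr
    _ = ENNReal.ofReal (B ^ 2 / k) + ENNReal.ofReal (A₀ * R) * I := by
        rw [lintegral_add_left measurable_const, lintegral_const_mul' _ _ ENNReal.ofReal_ne_top,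
          lintegral_const, measure_univ, mul_one]
    _ = _ := by
        nth_rewrite 1 [← ENNReal.ofReal_toReal hmom.ne]
        rw [← ENNReal.ofReal_mul (by positivity),
          ← ENNReal.ofReal_add (by positivity) (by positivity)]
        congr 2
        ring

/-! ### Combining the Monte Carlo and regression errors -/

lemma sq_add_mean_le {n : ℕ} (hn : 1 ≤ n) (a : ℝ) (u : Fin n → ℝ) :
    (a + (1 / (n : ℝ)) * ∑ i, u i) ^ 2 ≤ 2 * a ^ 2 + (2 / (n : ℝ)) * ∑ i, u i ^ 2 := by
  have hn' : (0 : ℝ) < n := by exact_mod_cast hn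
  have h1 : (∑ i, u i) ^ 2 ≤ n * ∑ i, u i ^ 2 := by
    simpa using sq_sum_le_card_mul_sum_sq (s := (Finset.univ : Finset (Fin n))) (f := u)
  have h2 : ((1 / (n : ℝ)) * ∑ i, u i) ^ 2 ≤ (1 / (n : ℝ)) * ∑ i, u i ^ 2 := by
    calc ((1 / (n : ℝ)) * ∑ i, u i) ^ 2 = (1 / (n : ℝ)) ^ 2 * (∑ i, u i) ^ 2 := by ring
      _ ≤ (1 / (n : ℝ)) ^ 2 * (n * ∑ i, u i ^ 2) := by gcongr
      _ = _ := by field_simp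
  have h3 : (2 / (n : ℝ)) * ∑ i, u i ^ 2 = 2 * ((1 / (n : ℝ)) * ∑ i, u i ^ 2) := by ring
  rw [h3]
  nlinarith [sq_nonneg (a - (1 / (n : ℝ)) * ∑ i, u i)]

/-- The mean square error of the estimator is bounded by the Monte Carlo error of the evaluation
sample and by the mean square error of the regression. -/
lemma integral_sq_quantityOfInterest_sub_le {E : Type*} [NormedAddCommGroup E]
    [MeasurableSpace E] [BorelSpace E] [SecondCountableTopology E] {T F : Type*}
    [MeasurableSpace T] [MeasurableSpace F]
    {f : E × T → F} (hf : Measurable f) {φ : F → ℝ} (hφ : Measurable φ)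
    {μX μX' : Measure E} [IsProbabilityMeasure μX] [IsProbabilityMeasure μX']
    {μΘ : Measure T} [IsProbabilityMeasure μΘ]
    {Ω : Type*} [MeasurableSpace Ω] {P : Measure Ω} [IsProbabilityMeasure P]
    {X X' : ℕ → Ω → E} {Θ : ℕ → Ω → T}
    (hsample : IsCovariateShiftSample P μX μX' μΘ X X' Θ) {B : ℝ} (hB : ∀ y, |φ y| ≤ B)
    (hψ : Measurable fun x => ∫ θ, φ (f (x, θ)) ∂μΘ) {k m n : ℕ} (hk : 1 ≤ k) (hkm : k ≤ m)
    (hn : 1 ≤ n) {δ : ℝ} (hδ0 : 0 ≤ δ)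
    (hδ : ∫⁻ z, ENNReal.ofReal (((∫ θ, φ (f (z.1, θ)) ∂μΘ) -
        knnRegression φ k z.2.1 (fun j => f (z.2.1 j, z.2.2 j)) z.1) ^ 2)
        ∂(μX.prod ((Measure.pi fun _ : Fin m => μX').prod (Measure.pi fun _ : Fin m => μΘ)))
      ≤ ENNReal.ofReal δ) :
    Integrable (fun ω => |quantityOfInterest μX μΘ f φ -
        estimatedQI φ k (fun j : Fin m => X' j ω) (fun j : Fin m => f (X' j ω, Θ j ω))
          (fun i : Fin n => X i ω)| ^ 2) P ∧
      ∫ ω, |quantityOfInterest μX μΘ f φ -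
        estimatedQI φ k (fun j : Fin m => X' j ω) (fun j : Fin m => f (X' j ω, Θ j ω))
          (fun i : Fin n => X i ω)| ^ 2 ∂P ≤ 2 * (B ^ 2 / n) + 2 * δ := by
  have hn' : (0 : ℝ) < n := by exact_mod_cast hn
  have hX := hsample.measurable_X
  have hX' := hsample.measurable_X'
  have hΘ := hsample.measurable_Θ
  set ψ : E → ℝ := fun x => ∫ θ, φ (f (x, θ)) ∂μΘ with hψdef
  have hψB : ∀ x, |ψ x| ≤ B := fun x =>
    abs_integral_le_of_abs_le μΘ fun θ => hB (f (x, θ))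
  let g : Fin n → Ω → ℝ := fun i ω =>
    knnRegression φ k (fun j : Fin m => X' j ω) (fun j : Fin m => f (X' j ω, Θ j ω)) (X i ω)
  have hg : ∀ i, Measurable (g i) := fun i =>
    measurable_knnRegression hφ k m (by fun_prop) (by fun_prop) (hX i)
  have hsq : ∀ i : Fin n, Integrable (fun ω => (ψ (X i ω) - g i ω) ^ 2) P := fun i => by
    refine Integrable.of_bound (((hψ.comp (hX i)).sub (hg i)).pow_const 2).aestronglyMeasurable
      ((B + B) ^ 2) (Eventually.of_forall fun ω => ?_)
    rw [norm_pow, Real.norm_eq_abs]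
    exact pow_le_pow_left₀ (abs_nonneg _) ((abs_sub _ _).trans
      (add_le_add (hψB _) (abs_knnRegression_le hB hk hkm _ _ _))) 2
  -- Each `X i` with the training data has the product law of `hδ`. The terms share training data;
  -- no independence between them is needed.
  have hsqle : ∀ i : Fin n, ∫ ω, (ψ (X i ω) - g i ω) ^ 2 ∂P ≤ δ := fun i => by
    rw [integral_eq_lintegral_of_nonneg_ae (Eventually.of_forall fun ω => sq_nonneg _)
      (hsq i).aestronglyMeasurable]
    refine ENNReal.toReal_le_of_le_ofReal hδ0 (le_trans (le_of_eq ?_) hδ)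
    rw [← hsample.map_prod_eq i m, lintegral_map _ (by fun_prop)]
    exact (((hψ.comp measurable_fst).sub (measurable_knnRegression hφ k m
      (by fun_prop) (by fun_prop) measurable_fst)).pow_const 2).ennreal_ofReal
  have hQ := quantityOfInterest_eq_integral μX μΘ hf hφ hB
  set Q := quantityOfInterest μX μΘ f φ with hQdef
  have hQB : |Q| ≤ B := by
    rw [hQ]
    exact abs_integral_le_of_abs_le μX hψB
  have hmc := integral_sq_mean_sub_integral_le hX hsample.law_X hsample.indep_X hψ hψB hn
  rw [← hQ] at hmc
  have hmcm : Measurable fun ω => Q - (1 / (n : ℝ)) * ∑ i : Fin n, ψ (X i ω) :=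
    measurable_const.sub ((Finset.measurable_sum Finset.univ fun (i : Fin n) _ =>
      hψ.comp (hX i)).const_mul _)
  have hmci : Integrable (fun ω => (Q - (1 / (n : ℝ)) * ∑ i : Fin n, ψ (X i ω)) ^ 2) P := by
    refine Integrable.of_bound (hmcm.pow_const 2).aestronglyMeasurable ((B + B) ^ 2)
      (Eventually.of_forall fun ω => ?_)
    rw [norm_pow, Real.norm_eq_abs]
    refine pow_le_pow_left₀ (abs_nonneg _) ((abs_sub _ _).trans (add_le_add hQB ?_)) 2
    rw [abs_mul, abs_of_pos (by positivity), one_div, inv_mul_le_iff₀ hn']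
    refine (Finset.abs_sum_le_sum_abs _ _).trans
      ((Finset.sum_le_sum fun i _ => hψB _).trans (by simp))
  have hbound : Integrable (fun ω => 2 * (Q - (1 / (n : ℝ)) * ∑ i : Fin n, ψ (X i ω)) ^ 2 +
      (2 / (n : ℝ)) * ∑ i : Fin n, (ψ (X i ω) - g i ω) ^ 2) P :=
    (hmci.const_mul 2).add ((integrable_finsetSum _ fun i _ => hsq i).const_mul _)
  have hle : ∀ ω, |Q - estimatedQI φ k (fun j : Fin m => X' j ω)
      (fun j : Fin m => f (X' j ω, Θ j ω)) (fun i : Fin n => X i ω)| ^ 2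
      ≤ 2 * (Q - (1 / (n : ℝ)) * ∑ i : Fin n, ψ (X i ω)) ^ 2 +
        (2 / (n : ℝ)) * ∑ i : Fin n, (ψ (X i ω) - g i ω) ^ 2 := fun ω => by
    refine le_trans (le_of_eq ?_) (sq_add_mean_le hn _ _)
    rw [sq_abs, estimatedQI, Finset.sum_sub_distrib]
    ring
  have hest : Measurable fun ω => |Q - estimatedQI φ k (fun j : Fin m => X' j ω)
      (fun j : Fin m => f (X' j ω, Θ j ω)) (fun i : Fin n => X i ω)| ^ 2 :=
    (measurable_norm.comp (measurable_const.sub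
      ((Finset.measurable_sum _ fun i _ => hg i).const_mul _))).pow_const 2
  have hint := hbound.mono' hest.aestronglyMeasurable (Eventually.of_forall fun ω => by
    rw [Real.norm_of_nonneg (by positivity)]
    exact hle ω)
  refine ⟨hint, (integral_mono hint hbound hle).trans ?_⟩
  rw [integral_add (hmci.const_mul 2) ((integrable_finsetSum _ fun i _ => hsq i).const_mul _),
    integral_const_mul, integral_const_mul, integral_finsetSum _ fun i _ => hsq i]
  refine add_le_add (by gcongr) ?_
  calc (2 / (n : ℝ)) * ∑ i : Fin n, ∫ ω, (ψ (X i ω) - g i ω) ^ 2 ∂P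
      ≤ (2 / (n : ℝ)) * ∑ _i : Fin n, δ := by gcongr with i; exact hsqle i
    _ = 2 * δ := by simp; field_simp

theorem proposition4p6
    -- the space `ℝ^d` with an arbitrary norm, and its Lebesgue measure
    {E : Type*} [NormedAddCommGroup E] [NormedSpace ℝ E] [FiniteDimensional ℝ E]
    [MeasurableSpace E] [BorelSpace E]
    (d : ℕ) (hd : 1 ≤ d) (hdim : Module.finrank ℝ E = d)
    (lam : Measure E) [lam.IsAddHaarMeasure]
    -- the model
    {T : Type*} [MeasurableSpace T] {e : ℕ}
    (f : E × T → (Fin e → ℝ)) (hf : Measurable f)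
    (φ : (Fin e → ℝ) → ℝ) (hφ : Measurable φ)
    (μX μX' : Measure E) [IsProbabilityMeasure μX] [IsProbabilityMeasure μX']
    (μΘ : Measure T) [IsProbabilityMeasure μΘ]
    -- the samples
    {Ω : Type*} [MeasurableSpace Ω] (P : Measure Ω) [IsProbabilityMeasure P]
    (X X' : ℕ → Ω → E) (Θ : ℕ → Ω → T)
    (hsample : IsCovariateShiftSample P μX μX' μΘ X X' Θ)
    -- `φ` is bounded and the regression function is globally Lipschitz continuous
    (hφb : ∃ B : ℝ, ∀ y, |φ y| ≤ B)
    (hψ : ∃ L : ℝ≥0, LipschitzWith L (fun x => ∫ θ, φ (f (x, θ)) ∂μΘ))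
    -- min-integrability of the training covariates and second moment of the evaluation covariates
    (hmin : ∃ m₀ : ℕ, 1 ≤ m₀ ∧ ∫⁻ ω, ⨅ j : Fin m₀, ‖X' j ω‖ₑ ∂P < ⊤)
    (hX2 : ∫⁻ x, ‖x‖ₑ ^ 2 ∂μX < ⊤)
    -- strong support condition, and the moment condition for `q = 2`
    (U : Set E) (p : E → ℝ) (hsupp : StrongSupportCondition d lam μX μX' U p)
    (hmom : ∫⁻ x, ENNReal.ofReal ((1 + ‖x‖ ^ 2) / p x ^ (2 / (d : ℝ))) ∂μX < ⊤)
    -- the rate `τ` of the empirical measure in expected `W₁` distance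
    (τ : ℕ → ℝ) (hτ₀ : ∀ n, 0 ≤ τ n)
    (hτ : ∃ A : ℝ, ∀ᶠ n : ℕ in atTop,
      ∫⁻ ω, wassersteinDist 1 μX (empiricalMeasure (fun i : Fin n => X i ω)) ∂P
        ≤ ENNReal.ofReal (A * τ n))
    -- the numbers of neighbours
    (k : ℕ → ℕ) (hk_pos : ∀ m, 1 ≤ m → 1 ≤ k m) (hk_mono : MonotoneOn k (Set.Ici 1))
    (hk : (fun m : ℕ => (k m : ℝ)) ~[atTop] (fun m : ℕ => (m : ℝ) ^ (2 / ((d : ℝ) + 2)))) :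
    ∃ C : ℝ, ∀ m n : ℕ, 1 ≤ m → 1 ≤ n → k m ≤ m →
      Integrable (fun ω => |quantityOfInterest μX μΘ f φ -
        estimatedQI φ (k m) (fun j : Fin m => X' j ω) (fun j : Fin m => f (X' j ω, Θ j ω))
          (fun i : Fin n => X i ω)| ^ 2) P ∧
      (∫ ω, |quantityOfInterest μX μΘ f φ -
        estimatedQI φ (k m) (fun j : Fin m => X' j ω) (fun j : Fin m => f (X' j ω, Θ j ω))
          (fun i : Fin n => X i ω)| ^ 2 ∂P) ^ (1 / 2 : ℝ)
        ≤ C * (1 / √(n : ℝ) + τ n) + C * (1 / (m : ℝ) ^ (1 / ((d : ℝ) + 2))) := by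

  obtain ⟨B, hB⟩ := hφb
  obtain ⟨L, hL⟩ := hψ
  obtain ⟨A, hA0, hA⟩ := exists_lintegral_sq_sub_knnRegression_le hd lam hf hφ μX μX' μΘ hB hL
    hsupp hmom
  obtain ⟨K, hK0, hK⟩ := exists_neighbors_rate hd hk_pos hk
  -- The first summand is the Monte Carlo constant, the second the regression constant; `D`
  -- dominates both.
  set D := 2 * B ^ 2 + 2 * ((B ^ 2 + A) * K) with hD
  have hD0 : 0 ≤ D := by positivity
  refine ⟨√D, fun m n hm hn hkm => ?_⟩
  obtain ⟨hK1, hK2⟩ := hK m hm hkm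
  have hn' : (0 : ℝ) < n := by exact_mod_cast hn
  set h := 1 / (m : ℝ) ^ (1 / ((d : ℝ) + 2)) with hh
  have hh0 : 0 ≤ h := by positivity
  have hδ0 : 0 ≤ B ^ 2 / k m + A * ((m / k m : ℕ) : ℝ) ^ (-(2 / (d : ℝ))) := by positivity
  obtain ⟨hint, hle⟩ := integral_sq_quantityOfInterest_sub_le hf hφ hsample hB
    hL.continuous.measurable (hk_pos m hm) hkm hn hδ0 (hA (k m) m (hk_pos m hm) hkm)
  refine ⟨hint, ?_⟩
  have hδ : B ^ 2 / k m + A * ((m / k m : ℕ) : ℝ) ^ (-(2 / (d : ℝ))) ≤ (B ^ 2 + A) * K * h ^ 2 := by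
    calc _ = B ^ 2 * (1 / k m) + A * ((m / k m : ℕ) : ℝ) ^ (-(2 / (d : ℝ))) := by ring
      _ ≤ B ^ 2 * (K * h ^ 2) + A * (K * h ^ 2) := by gcongr
      _ = _ := by ring
  have hs : (1 / √(n : ℝ)) ^ 2 = 1 / n := by
    rw [div_pow, one_pow, Real.sq_sqrt hn'.le]
  have hs0 : 0 ≤ 1 / √(n : ℝ) := by positivity
  have hBK : 0 ≤ (B ^ 2 + A) * K := by positivity
  rw [← Real.sqrt_eq_rpow]
  -- Bounding a sum of squares by the square of the sum makes the root split exactly into the two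
  -- rates.
  calc _ ≤ √(D * (1 / √(n : ℝ) + h) ^ 2) := by
        refine Real.sqrt_le_sqrt (hle.trans ?_)
        have h1 : 2 * (B ^ 2 / n) = 2 * B ^ 2 * (1 / √(n : ℝ)) ^ 2 := by rw [hs]; ring
        rw [h1]
        calc _ ≤ D * (1 / √(n : ℝ)) ^ 2 + D * h ^ 2 := by
              refine add_le_add ?_ ?_
              · gcongr
                linarith
              · calc _ ≤ 2 * ((B ^ 2 + A) * K * h ^ 2) := by gcongr
                  _ = 2 * ((B ^ 2 + A) * K) * h ^ 2 := by ring
                  _ ≤ _ := by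
                    gcongr
                    linarith [sq_nonneg B]
          _ = D * ((1 / √(n : ℝ)) ^ 2 + h ^ 2) := by ring
          _ ≤ _ := by
            gcongr
            nlinarith [mul_nonneg hs0 hh0]
    _ = √D * (1 / √(n : ℝ)) + √D * h := by
        rw [Real.sqrt_mul hD0, Real.sqrt_sq (by positivity), mul_add]
    _ ≤ _ := by
        gcongr
        linarith [hτ₀ n]
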